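/- Let $SL_2=SL_2(\mathbb{C})$ act on $\mathbb{C}^2$ in the standard way, and let $V_1$ be the space of linear binary forms (linear forms on $\mathbb{C}^2$) with the natural action $(g\cdot f)(v)=f(g^{-1}v)$. Let $nV_1=V_1\oplus\cdots\oplus V_1$ ($n$ summands) with the diagonal action, and for a representation $W$ of $SL_2$ let $\mathbb{C}[W]^{SL_2}$ be the algebra of polynomial functions on $W$ that are constant on $SL_2$-orbits. Put $\mathcal{I}_n=\mathbb{C}[nV_1]^{SL_2}$ (the algebra of joint invariants of $n$ linear binary forms) and $\mathcal{C}_n=\mathbb{C}[nV_1\oplus\mathbb{C}^2]^{SL_2}$ (the algebra of joint covariants). Then (i) $\operatorname{tr\,deg}_{\mathbb{C}}\mathcal{I}_n=2n-3$ for all $n\ge 2$; (ii) $\operatorname{tr\,deg}_{\mathbb{C}}\mathcal{C}_n=2n-1$ for all $n\ge 1$. -/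

import Mathlib

noncomputable section

/-- The algebra `ℂ[W]` of polynomial functions on a complex vector space `W`: the algebra of
functions on `W` generated by the linear functionals. -/
def polyFun (W : Type*) [AddCommGroup W] [Module ℂ W] : Subalgebra ℂ (W → ℂ) :=
  Algebra.adjoin ℂ (Set.range fun φ : Module.Dual ℂ W => (φ : W → ℂ))

/-- The algebra `ℂ[W]^G` of invariant polynomial functions on a representation `W` of `G`. -/
def invariantAlgebra {G W : Type*} [Group G] [AddCommGroup W] [Module ℂ W]
    (ρ : Representation ℂ G W) : Subalgebra ℂ (W → ℂ) where
  carrier := {p | p ∈ polyFun W ∧ ∀ (g : G) (w : W), p (ρ g w) = p w}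
  mul_mem' := fun {p q} hp hq =>
    ⟨mul_mem hp.1 hq.1, fun g w => by simp only [Pi.mul_apply, hp.2 g w, hq.2 g w]⟩
  add_mem' := fun {p q} hp hq =>
    ⟨add_mem hp.1 hq.1, fun g w => by simp only [Pi.add_apply, hp.2 g w, hq.2 g w]⟩
  algebraMap_mem' := fun c => ⟨(polyFun W).algebraMap_mem c, fun _ _ => rfl⟩

/-- The complex special linear group `SL₂`. -/
abbrev SL2 : Type := Matrix.SpecialLinearGroup (Fin 2) ℂ

/-- The standard representation of `SL₂` on `ℂ²`, `g` acting by `v ↦ g v`. -/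
def stdRep : Representation ℂ SL2 (Fin 2 → ℂ) where
  toFun g := Matrix.toLin' (g : Matrix (Fin 2) (Fin 2) ℂ)
  map_one' := by simp; rfl
  map_mul' g h := by
    rw [Matrix.SpecialLinearGroup.coe_mul, Matrix.toLin'_mul]
    rfl

/-- The space `V₁` of linear binary forms, that is, of linear forms on `ℂ²`. -/
abbrev LinForm : Type := Module.Dual ℂ (Fin 2 → ℂ)

/-- The natural action of `SL₂` on linear binary forms, `(g f)(v) = f (g⁻¹ v)`. -/
def formRep : Representation ℂ SL2 LinForm := stdRep.dual

/-- The diagonal action of `SL₂` on `n V₁ = V₁ ⊕ ⋯ ⊕ V₁` (`n` summands). -/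
def formsRep (n : ℕ) : Representation ℂ SL2 (Fin n → LinForm) where
  toFun g := (formRep g).compLeft (Fin n)
  map_one' := by ext; simp
  map_mul' g h := by ext; simp

/-- The algebra `I_n = ℂ[n V₁]^{SL₂}` of joint invariants of `n` linear binary forms. -/
def jointInvariants (n : ℕ) : Subalgebra ℂ ((Fin n → LinForm) → ℂ) :=
  invariantAlgebra (formsRep n)

/-- The algebra `C_n = ℂ[n V₁ ⊕ ℂ²]^{SL₂}` of joint covariants of `n` linear binary forms. -/
def jointCovariants (n : ℕ) : Subalgebra ℂ ((Fin n → LinForm) × (Fin 2 → ℂ) → ℂ) :=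
  invariantAlgebra ((formsRep n).prod stdRep)

end

noncomputable section

/-! The area form identifies linear forms with vectors equivariantly, so both algebras become
invariants of `k + 2` vectors in `ℂ²`, with `k + 2 = n` for invariants and `k + 2 = n + 1` for
covariants. If the bracket `t` of the first two vectors is nonzero, `SL₂` moves them to `(1, 0)` and
`(0, t)`; the remaining coordinates are then rational in the `2k + 1` brackets involving one of the
first two vectors. These brackets take arbitrary values on this slice once `t ≠ 0`, so they are
independent, and every invariant times a power of `t` is a polynomial in them. Hence they form a
transcendence basis. -/

/-- A polynomial function restricted to an affine line is a univariate polynomial. -/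
theorem exists_polynomial_of_mem_polyFun {W : Type*} [AddCommGroup W] [Module ℂ W]
    {p : W → ℂ} (hp : p ∈ polyFun W) (a b : W) :
    ∃ P : Polynomial ℂ, ∀ s : ℂ, p (a + s • b) = P.eval s := by
  induction hp using Algebra.adjoin_induction with
  | mem x hx =>
    obtain ⟨φ, rfl⟩ := hx
    exact ⟨Polynomial.C (φ a) + Polynomial.X * Polynomial.C (φ b), fun s => by simp; ring⟩
  | algebraMap r => exact ⟨Polynomial.C r, fun s => by simp⟩
  | add x y _ _ hx hy =>
    obtain ⟨P, hP⟩ := hx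
    obtain ⟨Q, hQ⟩ := hy
    exact ⟨P + Q, fun s => by simp [hP, hQ]⟩
  | mul x y _ _ hx hy =>
    obtain ⟨P, hP⟩ := hx
    obtain ⟨Q, hQ⟩ := hy
    exact ⟨P * Q, fun s => by simp [hP, hQ]⟩

/-- On the line joining a point where `p` is nonzero to one where `q` is nonzero, the claim reduces
to `ℂ[s]` being a domain. -/
theorem eq_zero_or_eq_zero_of_mem_polyFun {W : Type*} [AddCommGroup W] [Module ℂ W]
    {p q : W → ℂ} (hp : p ∈ polyFun W) (hq : q ∈ polyFun W) (h : p * q = 0) :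
    p = 0 ∨ q = 0 := by
  by_contra! hne
  obtain ⟨a, ha⟩ := Function.ne_iff.mp hne.1
  obtain ⟨b, hb⟩ := Function.ne_iff.mp hne.2
  obtain ⟨P, hP⟩ := exists_polynomial_of_mem_polyFun hp a (b - a)
  obtain ⟨Q, hQ⟩ := exists_polynomial_of_mem_polyFun hq a (b - a)
  have hPQ : P * Q = 0 := Polynomial.funext fun s => by
    simpa [hP, hQ] using congrFun h (a + s • (b - a))
  rcases mul_eq_zero.mp hPQ with h0 | h0
  · exact ha (by simpa [h0] using hP 0)
  · exact hb (by simpa [h0] using hQ 1)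

instance {G W : Type*} [Group G] [AddCommGroup W] [Module ℂ W] (ρ : Representation ℂ G W) :
    IsDomain (invariantAlgebra ρ) :=
  have : NoZeroDivisors (invariantAlgebra ρ) :=
    ⟨fun {p q} h => by
      have h' : (p : W → ℂ) * q = 0 := congrArg Subtype.val h
      exact (eq_zero_or_eq_zero_of_mem_polyFun p.2.1 q.2.1 h').imp Subtype.ext Subtype.ext⟩
  NoZeroDivisors.to_isDomain _

theorem comp_mem_polyFun {W W' : Type*} [AddCommGroup W] [Module ℂ W]
    [AddCommGroup W'] [Module ℂ W'] (e : W →ₗ[ℂ] W') {p : W' → ℂ} (hp : p ∈ polyFun W') :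
    p ∘ e ∈ polyFun W := by
  induction hp using Algebra.adjoin_induction with
  | mem x hx =>
    obtain ⟨φ, rfl⟩ := hx
    exact Algebra.subset_adjoin ⟨φ ∘ₗ e, rfl⟩
  | algebraMap r => exact (polyFun W).algebraMap_mem r
  | add x y _ _ hx hy => exact add_mem hx hy
  | mul x y _ _ hx hy => exact mul_mem hx hy

/-- An equivariant linear isomorphism identifies the algebras of invariants. -/
def invariantAlgebraCongr {G W W' : Type*} [Group G] [AddCommGroup W] [Module ℂ W]
    [AddCommGroup W'] [Module ℂ W'] {ρ : Representation ℂ G W} {ρ' : Representation ℂ G W'}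
    (e : W ≃ₗ[ℂ] W') (he : ∀ g w, e (ρ g w) = ρ' g (e w)) :
    invariantAlgebra ρ' ≃ₐ[ℂ] invariantAlgebra ρ where
  toFun p := ⟨p.1 ∘ e, comp_mem_polyFun e.toLinearMap p.2.1, fun g w => by
    simp [he, p.2.2]⟩
  invFun p := ⟨p.1 ∘ e.symm, comp_mem_polyFun e.symm.toLinearMap p.2.1, fun g w => by
    have : e.symm (ρ' g w) = ρ g (e.symm w) := by
      rw [LinearEquiv.symm_apply_eq, he, e.apply_symm_apply]
    simp [this, p.2.2]⟩
  left_inv p := by ext w; simp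
  right_inv p := by ext w; simp
  map_mul' _ _ := rfl
  map_add' _ _ := rfl
  commutes' _ := rfl

/-- The diagonal action of `SL₂` on `n`-tuples of vectors of `ℂ²`. -/
def vectorsRep (n : ℕ) : Representation ℂ SL2 (Fin n → Fin 2 → ℂ) where
  toFun g := (stdRep g).compLeft (Fin n)
  map_one' := by ext; simp
  map_mul' g h := by ext; simp

theorem stdRep_apply (g : SL2) (v : Fin 2 → ℂ) (i : Fin 2) :
    stdRep g v i = g i 0 * v 0 + g i 1 * v 1 := by
  simp [stdRep, Matrix.mulVec, dotProduct, Fin.sum_univ_two]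

theorem vectorsRep_apply {n : ℕ} (g : SL2) (v : Fin n → Fin 2 → ℂ) (j : Fin n) :
    vectorsRep n g v j = stdRep g (v j) := rfl

/-- The equivariant identification of linear binary forms with vectors given by the
`SL₂`-invariant area form. -/
def linFormEquiv : LinForm ≃ₗ[ℂ] (Fin 2 → ℂ) where
  toFun f := ![f (Pi.single 1 1), -f (Pi.single 0 1)]
  map_add' f f' := by ext i; fin_cases i <;> simp [add_comm]
  map_smul' c f := by ext i; fin_cases i <;> simp
  invFun v := v 0 • LinearMap.proj 1 - v 1 • LinearMap.proj 0
  left_inv f := by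
    ext i
    fin_cases i <;> simp
  right_inv v := by ext i; fin_cases i <;> simp

theorem linForm_apply (f : LinForm) (v : Fin 2 → ℂ) :
    f v = v 0 * f (Pi.single 0 1) + v 1 * f (Pi.single 1 1) := by
  have hv : v = v 0 • Pi.single 0 1 + v 1 • Pi.single 1 1 := by
    ext i; fin_cases i <;> simp
  conv_lhs => rw [hv]
  simp only [map_add, map_smul, smul_eq_mul]

theorem linFormEquiv_formRep (g : SL2) (f : LinForm) :
    linFormEquiv (formRep g f) = stdRep g (linFormEquiv f) := by
  have h : ∀ v, formRep g f v = f (stdRep g⁻¹ v) := fun _ => rfl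
  have h0 : ∀ f : LinForm, linFormEquiv f 0 = f (Pi.single 1 1) := fun _ => rfl
  have h1 : ∀ f : LinForm, linFormEquiv f 1 = -f (Pi.single 0 1) := fun _ => rfl
  ext i
  rw [stdRep_apply]
  fin_cases i <;>
    simp [h0, h1, h, linForm_apply f (stdRep _ _), stdRep_apply,
      Matrix.SpecialLinearGroup.coe_inv, Matrix.adjugate_fin_two]
  ring

/-- The area form on `ℂ²`. -/
def bracket (u v : Fin 2 → ℂ) : ℂ := u 0 * v 1 - u 1 * v 0

theorem bracket_stdRep (g : SL2) (u v : Fin 2 → ℂ) :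
    bracket (stdRep g u) (stdRep g v) = bracket u v := by
  have h := Matrix.det_fin_two (g : Matrix (Fin 2) (Fin 2) ℂ)
  rw [g.2] at h
  simp only [bracket, stdRep_apply]
  linear_combination -(u 0 * v 1 - u 1 * v 0) * h

/-- The bracket of two of the vectors, as an invariant. -/
def bracketInvariant {n : ℕ} (i j : Fin n) : invariantAlgebra (vectorsRep n) :=
  ⟨fun w => bracket (w i) (w j), by
    have coord : ∀ (i : Fin n) (a : Fin 2), (fun w : Fin n → Fin 2 → ℂ => w i a) ∈
        polyFun (Fin n → Fin 2 → ℂ) := fun i a =>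
      Algebra.subset_adjoin ⟨LinearMap.proj a ∘ₗ LinearMap.proj i, rfl⟩
    exact sub_mem (mul_mem (coord i 0) (coord j 1)) (mul_mem (coord i 1) (coord j 0)),
   fun g w => bracket_stdRep g (w i) (w j)⟩

/-- The brackets involving one of the first two vectors. -/
def basicBracket (k : ℕ) : Option (Fin k ⊕ Fin k) → invariantAlgebra (vectorsRep (k + 2))
  | none => bracketInvariant 0 1
  | some (.inl j) => bracketInvariant 0 j.succ.succ
  | some (.inr j) => bracketInvariant j.succ.succ 1

/-- The tuple with first vectors `(1, 0)` and `(0, t)` at which the basic brackets take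
prescribed values, `t ≠ 0` being the first of them. -/
def sliceTuple {k : ℕ} (c : Option (Fin k ⊕ Fin k) → ℂ) : Fin (k + 2) → Fin 2 → ℂ :=
  Fin.cons ![1, 0] (Fin.cons ![0, c none]
    fun j => ![c (some (.inr j)) / c none, c (some (.inl j))])

theorem sliceTuple_zero {k : ℕ} (c : Option (Fin k ⊕ Fin k) → ℂ) : sliceTuple c 0 = ![1, 0] :=
  rfl

theorem sliceTuple_one {k : ℕ} (c : Option (Fin k ⊕ Fin k) → ℂ) :
    sliceTuple c 1 = ![0, c none] := rfl

theorem sliceTuple_succ_succ {k : ℕ} (c : Option (Fin k ⊕ Fin k) → ℂ) (j : Fin k) :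
    sliceTuple c j.succ.succ = ![c (some (.inr j)) / c none, c (some (.inl j))] := rfl

theorem basicBracket_sliceTuple {k : ℕ} (c : Option (Fin k ⊕ Fin k) → ℂ) (hc : c none ≠ 0)
    (i : Option (Fin k ⊕ Fin k)) : (basicBracket k i).1 (sliceTuple c) = c i := by
  rcases i with _ | j | j <;>
    simp [basicBracket, bracketInvariant, bracket, sliceTuple_zero, sliceTuple_one,
      sliceTuple_succ_succ, hc]

theorem exists_vectorsRep_eq_sliceTuple {k : ℕ} (w : Fin (k + 2) → Fin 2 → ℂ)
    (hw : (basicBracket k none).1 w ≠ 0) :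
    ∃ g : SL2, vectorsRep (k + 2) g w = sliceTuple fun i => (basicBracket k i).1 w := by
  have hw' : w 0 0 * w 1 1 - w 0 1 * w 1 0 ≠ 0 := hw
  obtain ⟨t, ht⟩ : ∃ t, t = w 0 0 * w 1 1 - w 0 1 * w 1 0 := ⟨_, rfl⟩
  rw [← ht] at hw'
  -- The inverse of the matrix with columns `w 0` and `w 1 / t`.
  have hdet : (!![w 1 1 / t, -w 1 0 / t; -w 0 1, w 0 0] : Matrix (Fin 2) (Fin 2) ℂ).det = 1 := by
    rw [Matrix.det_fin_two_of]
    field_simp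
    linear_combination -ht
  let g : SL2 := ⟨_, hdet⟩
  have h0 : ∀ v, stdRep g v 0 = w 1 1 / t * v 0 + -w 1 0 / t * v 1 :=
    fun v => stdRep_apply g v 0
  have h1 : ∀ v, stdRep g v 1 = -w 0 1 * v 0 + w 0 0 * v 1 :=
    fun v => stdRep_apply g v 1
  refine ⟨g, ?_⟩
  clear_value g
  have hb0 : (basicBracket k none).1 w = t := ht.symm
  have hb1 : ∀ j, (basicBracket k (some (.inl j))).1 w =
    w 0 0 * w j.succ.succ 1 - w 0 1 * w j.succ.succ 0 := fun _ => rfl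
  have hb2 : ∀ j, (basicBracket k (some (.inr j))).1 w =
    w j.succ.succ 0 * w 1 1 - w j.succ.succ 1 * w 1 0 := fun _ => rfl
  funext j
  rw [vectorsRep_apply]
  refine Fin.cases ?_ (Fin.cases ?_ fun j => ?_) j
  · rw [sliceTuple_zero]
    ext a
    fin_cases a
    · simp only [Fin.zero_eta, h0, Matrix.cons_val_zero]
      field_simp
      linear_combination -ht
    · simp only [Fin.mk_one, h1, Matrix.cons_val_one, Matrix.cons_val_fin_one]
      ring
  · change stdRep _ (w 1) = sliceTuple _ 1
    rw [sliceTuple_one]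
    ext a
    fin_cases a
    · simp only [Fin.zero_eta, h0, Matrix.cons_val_zero]
      ring
    · simp only [Fin.mk_one, h1, hb0, Matrix.cons_val_one, Matrix.cons_val_fin_one]
      linear_combination -ht
  · rw [sliceTuple_succ_succ]
    ext a
    fin_cases a
    · simp only [Fin.zero_eta, h0, hb0, hb2, Matrix.cons_val_zero]
      ring
    · simp only [Fin.mk_one, h1, hb1, Matrix.cons_val_one, Matrix.cons_val_fin_one]
      ring

/-- On the slice a polynomial function is a polynomial in the parameters up to a power of the
first one. -/
theorem exists_mvPolynomial_of_mem_polyFun {k : ℕ} {p : (Fin (k + 2) → Fin 2 → ℂ) → ℂ}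
    (hp : p ∈ polyFun (Fin (k + 2) → Fin 2 → ℂ)) :
    ∃ (N : ℕ) (Q : MvPolynomial (Option (Fin k ⊕ Fin k)) ℂ), ∀ c, c none ≠ 0 →
      c none ^ N * p (sliceTuple c) = MvPolynomial.eval c Q := by
  have hadd : ∀ x y : (Fin (k + 2) → Fin 2 → ℂ) → ℂ,
      (∃ (N : ℕ) (Q : MvPolynomial (Option (Fin k ⊕ Fin k)) ℂ), ∀ c, c none ≠ 0 →
        c none ^ N * x (sliceTuple c) = MvPolynomial.eval c Q) →
      (∃ (N : ℕ) (Q : MvPolynomial (Option (Fin k ⊕ Fin k)) ℂ), ∀ c, c none ≠ 0 →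
        c none ^ N * y (sliceTuple c) = MvPolynomial.eval c Q) →
      ∃ (N : ℕ) (Q : MvPolynomial (Option (Fin k ⊕ Fin k)) ℂ), ∀ c, c none ≠ 0 →
        c none ^ N * (x + y) (sliceTuple c) = MvPolynomial.eval c Q := by
    rintro x y ⟨N, P, hP⟩ ⟨M, Q, hQ⟩
    refine ⟨N + M, MvPolynomial.X none ^ M * P + MvPolynomial.X none ^ N * Q, fun c hc => ?_⟩
    simp only [Pi.add_apply, map_add, map_mul, map_pow, MvPolynomial.eval_X, ← hP c hc, ← hQ c hc]
    ring
  induction hp using Algebra.adjoin_induction with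
  | algebraMap r => exact ⟨0, MvPolynomial.C r, fun c _ => by simp⟩
  | add x y _ _ hx hy => exact hadd x y hx hy
  | mul x y _ _ hx hy =>
    obtain ⟨N, P, hP⟩ := hx
    obtain ⟨M, Q, hQ⟩ := hy
    refine ⟨N + M, P * Q, fun c hc => ?_⟩
    simp only [Pi.mul_apply, map_mul, ← hP c hc, ← hQ c hc]
    ring
  | mem x hx =>
    obtain ⟨φ, rfl⟩ := hx
    -- The slice coordinates multiplied by `c none`, which clears their only denominator.
    let P : Fin (k + 2) → Fin 2 → MvPolynomial (Option (Fin k ⊕ Fin k)) ℂ :=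
      Fin.cons ![MvPolynomial.X none, 0] (Fin.cons ![0, MvPolynomial.X none ^ 2]
        fun j => ![MvPolynomial.X (some (.inr j)),
          MvPolynomial.X none * MvPolynomial.X (some (.inl j))])
    have hP : ∀ c, c none ≠ 0 → ∀ j a,
        MvPolynomial.eval c (P j a) = c none * sliceTuple c j a := by
      intro c hc j a
      refine Fin.cases ?_ (Fin.cases ?_ fun j => ?_) j <;> fin_cases a <;>
        simp [P, sliceTuple] <;> field_simp
    have hφ : ∀ w, φ w = ∑ j, ∑ a, w j a * φ (Pi.single j (Pi.single a 1)) := by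
      intro w
      conv_lhs => rw [← Finset.univ_sum_single w, map_sum]
      refine Finset.sum_congr rfl fun j _ => ?_
      rw [Fin.sum_univ_two]
      exact linForm_apply (φ ∘ₗ LinearMap.single ℂ (fun _ => Fin 2 → ℂ) j) (w j)
    refine ⟨1, ∑ j, ∑ a, P j a * MvPolynomial.C (φ (Pi.single j (Pi.single a 1))),
      fun c hc => ?_⟩
    simp only [map_sum, map_mul, MvPolynomial.eval_C, hP c hc, pow_one, hφ (sliceTuple c),
      Finset.mul_sum, mul_assoc]

theorem coe_aeval_apply {G W σ : Type*} [Group G] [AddCommGroup W] [Module ℂ W]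
    {ρ : Representation ℂ G W} (x : σ → invariantAlgebra ρ) (Q : MvPolynomial σ ℂ) (w : W) :
    (MvPolynomial.aeval x Q).1 w = MvPolynomial.eval (fun i => (x i).1 w) Q := by
  induction Q using MvPolynomial.induction_on with
  | C a => rw [MvPolynomial.aeval_C, MvPolynomial.eval_C]; rfl
  | add p q hp hq => simp [hp, hq]
  | mul_X p i hp => simp [hp]

theorem algebraicIndependent_basicBracket (k : ℕ) :
    AlgebraicIndependent ℂ (basicBracket k) := by
  rw [algebraicIndependent_iff]
  intro Q hQ
  -- The factor `X none` makes the vanishing trivial at `c none = 0`, where the slice gives no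
  -- information.
  have h : MvPolynomial.X none * Q = 0 := MvPolynomial.funext fun c => by
    by_cases hc : c none = 0
    · simp [hc]
    · have := coe_aeval_apply (basicBracket k) Q (sliceTuple c)
      simp only [hQ, basicBracket_sliceTuple c hc] at this
      rw [map_mul, ← this]
      simp
  exact (mul_eq_zero.mp h).resolve_left (MvPolynomial.X_ne_zero _)

theorem isAlgebraic_adjoin_basicBracket (k : ℕ) :
    Algebra.IsAlgebraic (Algebra.adjoin ℂ (Set.range (basicBracket k)))
      (invariantAlgebra (vectorsRep (k + 2))) := by
  refine ⟨fun p => ?_⟩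
  obtain ⟨N, Q, hQ⟩ := exists_mvPolynomial_of_mem_polyFun p.2.1
  have hmem : ∀ P : MvPolynomial (Option (Fin k ⊕ Fin k)) ℂ, MvPolynomial.aeval (basicBracket k) P ∈
      Algebra.adjoin ℂ (Set.range (basicBracket k)) := fun P => by
    rw [Algebra.adjoin_range_eq_range_aeval]
    exact ⟨P, rfl⟩
  -- The exponent is `N + 1` rather than `N` so that both sides vanish where the first bracket does;
  -- elsewhere `w` can be moved into the slice.
  have heq : MvPolynomial.aeval (R := ℂ) (basicBracket k) (MvPolynomial.X none ^ (N + 1)) * p =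
      MvPolynomial.aeval (R := ℂ) (basicBracket k) (MvPolynomial.X none * Q) := by
    refine Subtype.ext (funext fun w => ?_)
    change (MvPolynomial.aeval (R := ℂ) (basicBracket k) (MvPolynomial.X none ^ (N + 1))).1 w * p.1 w = _
    rw [coe_aeval_apply, coe_aeval_apply]
    by_cases hw : (basicBracket k none).1 w = 0
    · simp [hw]
    · obtain ⟨g, hg⟩ := exists_vectorsRep_eq_sliceTuple w hw
      rw [← p.2.2 g w, hg, map_mul, ← hQ _ hw]
      simp only [map_pow, MvPolynomial.eval_X]
      ring
  have hne : MvPolynomial.aeval (R := ℂ) (basicBracket k) (MvPolynomial.X none ^ (N + 1)) ≠ 0 := by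
    rw [map_pow, MvPolynomial.aeval_X]
    exact pow_ne_zero _ ((algebraicIndependent_basicBracket k).ne_zero none)
  -- The relation has degree one in `p`: every invariant is a quotient of polynomials in the
  -- brackets.
  refine ⟨Polynomial.C ⟨_, hmem (MvPolynomial.X none ^ (N + 1))⟩ * Polynomial.X -
    Polynomial.C ⟨_, hmem (MvPolynomial.X none * Q)⟩, fun h => hne ?_, ?_⟩
  · simpa using congrArg (fun P : Polynomial (Algebra.adjoin ℂ (Set.range (basicBracket k))) =>
      ((P.coeff 1).1 : invariantAlgebra (vectorsRep (k + 2)))) h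
  · rw [map_sub, map_mul, Polynomial.aeval_C, Polynomial.aeval_C, Polynomial.aeval_X]
    exact sub_eq_zero.mpr heq

theorem trdeg_invariantAlgebra_vectorsRep (k : ℕ) :
    Algebra.trdeg ℂ (invariantAlgebra (vectorsRep (k + 2))) = ((2 * k + 1 : ℕ) : Cardinal) := by
  have hb : IsTranscendenceBasis ℂ (basicBracket k) :=
    (algebraicIndependent_basicBracket k).isTranscendenceBasis_iff_isAlgebraic.mpr
      (isAlgebraic_adjoin_basicBracket k)
  rw [← hb.cardinalMk_eq_trdeg, Cardinal.mk_fintype]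
  simp [two_mul]

end

theorem theorem2 (n : ℕ) :
    (2 ≤ n → Algebra.trdeg ℂ (jointInvariants n) = ((2 * n - 3 : ℕ) : Cardinal)) ∧
    (1 ≤ n → Algebra.trdeg ℂ (jointCovariants n) = ((2 * n - 1 : ℕ) : Cardinal)) := by
  constructor
  · intro hn
    obtain ⟨k, rfl⟩ := Nat.exists_eq_add_of_le' hn
    have e := invariantAlgebraCongr (ρ := formsRep (k + 2)) (ρ' := vectorsRep (k + 2))
      (LinearEquiv.piCongrRight fun _ => linFormEquiv)
      fun g f => funext fun j => linFormEquiv_formRep g (f j)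
    rw [jointInvariants, ← e.trdeg_eq, trdeg_invariantAlgebra_vectorsRep]
    congr 1
  · intro hn
    obtain ⟨k, rfl⟩ := Nat.exists_eq_add_of_le' hn
    have e := invariantAlgebraCongr (ρ := (formsRep (k + 1)).prod stdRep)
      (ρ' := vectorsRep (k + 2))
      -- The argument of the covariant becomes vector number 0 of the tuple.
      ((LinearEquiv.prodComm ℂ _ _ ≪≫ₗ LinearEquiv.prodCongr (.refl ℂ _)
        (LinearEquiv.piCongrRight fun _ => linFormEquiv)) ≪≫ₗ
          Fin.consLinearEquiv ℂ (fun _ : Fin (k + 2) => Fin 2 → ℂ))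
      fun g f => funext fun j => by
        refine Fin.cases rfl (fun j => ?_) j
        exact linFormEquiv_formRep g (f.1 j)
    rw [jointCovariants, ← e.trdeg_eq, trdeg_invariantAlgebra_vectorsRep]
    congr 1
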